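/- There is an absolute constant $C$ such that the following holds. Let $n\equiv 3 \pmod 4$ be a natural number, $\ell=(n+1)/4$, $[n]=\{1,\dots,n\}$, and $$A=\{(a,b)\in 2^{[n]}\times 2^{[n]} : |a|=|b|=\ell,\ |a\cap b|=0\},\qquad B=\{(a,b)\in 2^{[n]}\times 2^{[n]} : |a|=|b|=\ell,\ |a\cap b|=1\}.$$ Let $\mu$ be any probability distribution on pairs $(a,b)$ of subsets of $[n]$ that is supported on $A\cup B$, gives positive probability to both $A$ and $B$, and is uniform when conditioned on $A$ and when conditioned on $B$. Let $f,g:2^{[n]}\to\mathbb{R}$ be nonnegative functions, and let $X$ be the random variable $X(a,b)=f(a)g(b)$. Then for every $0<\varepsilon<1$, $$(1-\varepsilon)\,\mathbb{E}[X\mid A]-\mathbb{E}[X\mid B]\ \le\ \max_{(a,b)\in A\cup B}|X(a,b)|\cdot 2^{-\frac{\varepsilon^2}{16\ln 2}\,\ell+C\log_2 \ell}.$$ -/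

import Mathlib

open MeasureTheory ProbabilityTheory

/-- The pairs `(a, b)` of `ℓ`-subsets of `[n]` with `|a ∩ b| = k`. -/
def pairsMeetingIn (n ℓ k : ℕ) : Finset (Finset (Fin n) × Finset (Fin n)) :=
  Finset.univ.filter fun p => p.1.card = ℓ ∧ p.2.card = ℓ ∧ (p.1 ∩ p.2).card = k

/-- The disjoint pairs of `ℓ`-subsets of `[n]` (the set `A`). -/
def disjointPairs (n ℓ : ℕ) : Finset (Finset (Fin n) × Finset (Fin n)) :=
  pairsMeetingIn n ℓ 0

/-- The barely intersecting pairs of `ℓ`-subsets of `[n]` (the set `B`). -/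
def barelyIntersectingPairs (n ℓ : ℕ) : Finset (Finset (Fin n) × Finset (Fin n)) :=
  pairsMeetingIn n ℓ 1

/-- The distributions on pairs of subsets of `[n]` that are supported on the disjoint and the
barely intersecting pairs of `ℓ`-subsets, and are uniform when conditioned to either class.
(As `uniformOn` of a nonempty finite set is a probability measure, while conditioning on a null
event gives the zero measure, both classes have positive probability.) -/
structure IsUniformOnEachClass (n ℓ : ℕ)
    (μ : Measure (Finset (Fin n) × Finset (Fin n))) : Prop where
  isProbabilityMeasure : IsProbabilityMeasure μ
  support : ∀ᵐ p ∂μ, p ∈ disjointPairs n ℓ ∪ barelyIntersectingPairs n ℓ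
  cond_disjoint :
    μ[|(disjointPairs n ℓ : Set (Finset (Fin n) × Finset (Fin n)))] =
      uniformOn (disjointPairs n ℓ : Set (Finset (Fin n) × Finset (Fin n)))
  cond_barelyIntersecting :
    μ[|(barelyIntersectingPairs n ℓ : Set (Finset (Fin n) × Finset (Fin n)))] =
      uniformOn (barelyIntersectingPairs n ℓ : Set (Finset (Fin n) × Finset (Fin n)))

/-- The conditional expectation `𝔼[X | S]` of `X` given the event `S`. -/
noncomputable def expectGiven {n : ℕ} (μ : Measure (Finset (Fin n) × Finset (Fin n)))
    (X : Finset (Fin n) × Finset (Fin n) → ℝ)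
    (S : Finset (Finset (Fin n) × Finset (Fin n))) : ℝ :=
  ∫ p, X p ∂μ[|(S : Set (Finset (Fin n) × Finset (Fin n)))]

/-- The maximum norm `‖X ↾ S‖_∞` of the restriction of `X` to a finite set `S`
(the norm of `S → ℝ` is the supremum norm). -/
noncomputable def maxNormOn {n : ℕ} (X : Finset (Fin n) × Finset (Fin n) → ℝ)
    (S : Finset (Finset (Fin n) × Finset (Fin n))) : ℝ :=
  ‖(fun p : S => X p)‖

/-! Write k for ℓ, so n + 1 = 4k. A point i in a 2k-set S determines the opposite 2k-set {i} ∪ Sᶜ,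
which meets S only in i. Choose k-subsets a of S and b of the opposite set: if both avoid i, they
are disjoint; if both contain i, they meet exactly in i. Each disjoint pair arises equally often,
and so does each barely intersecting pair, so both averages are sums over (i, S) of products of an
f-sum and a g-sum.

For fixed S, few points i can have avoiding f-sum well above the containing one: a typical k-subset
of S splits any U ⊆ S almost evenly, and the Chernoff bound makes the exceptions exponentially rare
(`sum_posPart_avoidingSum_sub_containingSum_le`). This applies with the weight g because the
avoiding g-sum on the opposite side runs over subsets of Sᶜ and does not depend on i
(`avoidingSum_oppositePointed`). Passing from avoiding to containing in f, and symmetrically in g,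
costs a fraction ε/2 each (`sum_avoiding_sub_sum_containing_le`). -/

/-! ### Concentration for the k-subsets of a fixed 2k-set -/

section Slices

variable {α : Type*} [DecidableEq α]

/-- The sum of `f` over the `k`-subsets of `S` avoiding `i`. -/
def avoidingSum (f : Finset α → ℝ) (k : ℕ) (i : α) (S : Finset α) : ℝ :=
  ∑ a ∈ S.powersetCard k with i ∉ a, f a

/-- The sum of `f` over the `k`-subsets of `S` containing `i`. -/
def containingSum (f : Finset α → ℝ) (k : ℕ) (i : α) (S : Finset α) : ℝ :=
  ∑ a ∈ S.powersetCard k with i ∈ a, f a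

/-- The number of elements of `U` outside `a` minus the number of those in `a`. -/
def imbalance (U a : Finset α) : ℝ :=
  ∑ i ∈ U, if i ∈ a then -1 else 1

lemma imbalance_le_card (U a : Finset α) : imbalance U a ≤ U.card := by
  unfold imbalance
  calc _ ≤ ∑ i ∈ U, (1 : ℝ) := Finset.sum_le_sum fun i _ => by split_ifs <;> norm_num
    _ = U.card := by simp

/-- The sum factorizes over the points of S: a point of U contributes 2 cosh t, any other point 2,
and both are at most 2 exp(t²/2). -/
lemma sum_exp_imbalance_le {U S : Finset α} (hU : U ⊆ S) (t : ℝ) :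
    ∑ a ∈ S.powerset, Real.exp (t * imbalance U a) ≤ (2 * Real.exp (t ^ 2 / 2)) ^ S.card := by
  have key : ∀ a ∈ S.powerset, Real.exp (t * imbalance U a) =
      (∏ i ∈ a, if i ∈ U then Real.exp (-t) else 1) *
        ∏ i ∈ S \ a, if i ∈ U then Real.exp t else 1 := by
    intro a ha
    have haS := Finset.mem_powerset.1 ha
    have h1 : imbalance U a = ∑ i ∈ S, if i ∈ U then (if i ∈ a then (-1 : ℝ) else 1) else 0 := by
      rw [imbalance, ← Finset.sum_filter, Finset.filter_mem_eq_inter,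
        Finset.inter_eq_right.2 hU]
    rw [h1, Finset.mul_sum, Real.exp_sum, ← Finset.prod_sdiff haS, mul_comm]
    congr 1
    · refine Finset.prod_congr rfl fun i hi => ?_
      by_cases hiU : i ∈ U <;> simp [hi, hiU]
    · refine Finset.prod_congr rfl fun i hi => ?_
      have hia := (Finset.mem_sdiff.1 hi).2
      by_cases hiU : i ∈ U <;> simp [hia, hiU]
  rw [Finset.sum_congr rfl key, ← Finset.prod_add, ← Finset.prod_const]
  refine Finset.prod_le_prod (fun i _ => by split_ifs <;> positivity) fun i _ => ?_
  split_ifs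
  · have h := Real.cosh_le_exp_half_sq t
    rw [Real.cosh_eq] at h
    linarith
  · have h : 1 ≤ Real.exp (t ^ 2 / 2) := Real.one_le_exp (by positivity)
    linarith

lemma sum_avoidingSum (f : Finset α → ℝ) {k : ℕ} {S : Finset α} (hS : S.card = 2 * k) :
    ∑ i ∈ S, avoidingSum f k i S = k * ∑ a ∈ S.powersetCard k, f a := by
  unfold avoidingSum
  rw [Finset.sum_comm' (t' := S.powersetCard k) (s' := fun a => S \ a)
    (by intro x y; simp only [Finset.mem_filter, Finset.mem_sdiff]; tauto), Finset.mul_sum]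
  refine Finset.sum_congr rfl fun a ha => ?_
  obtain ⟨haS, hac⟩ := Finset.mem_powersetCard.1 ha
  have : (S \ a).card = k := by rw [Finset.card_sdiff_of_subset haS]; omega
  simp [this]

lemma sum_avoidingSum_sub_containingSum (f : Finset α → ℝ) (k : ℕ) (U S : Finset α) :
    ∑ i ∈ U, (avoidingSum f k i S - containingSum f k i S) =
      ∑ a ∈ S.powersetCard k, f a * imbalance U a := by
  unfold avoidingSum containingSum imbalance
  simp_rw [Finset.mul_sum]
  rw [Finset.sum_comm]
  refine Finset.sum_congr rfl fun i _ => ?_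
  rw [Finset.sum_filter, Finset.sum_filter, ← Finset.sum_sub_distrib]
  refine Finset.sum_congr rfl fun a _ => ?_
  split_ifs <;> simp_all

lemma imbalance_le_add_exp {U S : Finset α} (hU : U ⊆ S) (a : Finset α) {t : ℝ} (ht : 0 ≤ t)
    (θ : ℝ) (hθ : 0 ≤ θ) :
    imbalance U a ≤ θ + S.card * Real.exp (t * imbalance U a - t * θ) := by
  rcases le_or_gt (imbalance U a) θ with h | h
  · have : 0 ≤ S.card * Real.exp (t * imbalance U a - t * θ) := by positivity
    linarith
  · have h1 : (1 : ℝ) ≤ Real.exp (t * imbalance U a - t * θ) :=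
      Real.one_le_exp (by nlinarith)
    have h2 : imbalance U a ≤ S.card :=
      (imbalance_le_card U a).trans (by exact_mod_cast Finset.card_le_card hU)
    have h3 : (S.card : ℝ) * 1 ≤ S.card * Real.exp (t * imbalance U a - t * θ) := by gcongr
    linarith

/-- The constant c stands for the sum of g over the k-subsets of Sᶜ. Sets a of imbalance at most
εk/2 give the main term; the rest are paid for by the uniform bound m. -/
lemma sum_posPart_avoidingSum_sub_containingSum_le {f : Finset α → ℝ} (hf : ∀ a, 0 ≤ f a)
    {k : ℕ} {S : Finset α} (hS : S.card = 2 * k) {c m ε : ℝ} (hc : 0 ≤ c) (hm : 0 ≤ m)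
    (hfc : ∀ a ∈ S.powersetCard k, f a * c ≤ m) (hε : 0 ≤ ε) :
    ∑ i ∈ S, max (avoidingSum f k i S - containingSum f k i S) 0 * c ≤
      ε / 2 * ∑ i ∈ S, avoidingSum f k i S * c
        + m * (2 * k) * (4 ^ k * Real.exp (-(ε ^ 2 * k / 16))) := by
  -- Summing over this U turns the positive parts into a linear expression in f.
  set U := S.filter fun i => 0 ≤ avoidingSum f k i S - containingSum f k i S with hUdef
  have hU : U ⊆ S := Finset.filter_subset _ _
  have h1 : ∑ i ∈ S, max (avoidingSum f k i S - containingSum f k i S) 0 =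
      ∑ a ∈ S.powersetCard k, f a * imbalance U a := by
    rw [← sum_avoidingSum_sub_containingSum, hUdef, Finset.sum_filter]
    refine Finset.sum_congr rfl fun i _ => ?_
    split_ifs with h
    · exact max_eq_left h
    · exact max_eq_right (not_le.1 h).le
  rw [← Finset.sum_mul, ← Finset.sum_mul, h1, sum_avoidingSum f hS, Finset.sum_mul]
  set E : Finset α → ℝ := fun a =>
    Real.exp (ε / 4 * imbalance U a - ε / 4 * (ε * k / 2)) with hE
  have h2 : ∀ a ∈ S.powersetCard k, f a * imbalance U a * c ≤
      ε * k / 2 * (f a * c) + m * (2 * k) * E a := by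
    intro a ha
    -- With θ = εk/2 the exponent k t² - tθ is least at t = ε/4, where it equals -ε²k/16.
    have hZ := imbalance_le_add_exp hU a (t := ε / 4) (by positivity) (ε * k / 2) (by positivity)
    rw [hS] at hZ
    push_cast at hZ
    calc f a * imbalance U a * c = (f a * c) * imbalance U a := by ring
      _ ≤ (f a * c) * (ε * k / 2 + 2 * k * E a) :=
          mul_le_mul_of_nonneg_left hZ (mul_nonneg (hf a) hc)
      _ = ε * k / 2 * (f a * c) + (f a * c) * (2 * k * E a) := by ring
      _ ≤ ε * k / 2 * (f a * c) + m * (2 * k * E a) := by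
          gcongr
          exact hfc a ha
      _ = _ := by ring
  have h3 : ∑ a ∈ S.powersetCard k, E a ≤ 4 ^ k * Real.exp (-(ε ^ 2 * k / 16)) := by
    calc ∑ a ∈ S.powersetCard k, E a ≤ ∑ a ∈ S.powerset, E a :=
          Finset.sum_le_sum_of_subset_of_nonneg (fun a ha => Finset.mem_powerset.2 (Finset.mem_powersetCard.1 ha).1)
            fun _ _ _ => (Real.exp_pos _).le
      _ = (∑ a ∈ S.powerset, Real.exp (ε / 4 * imbalance U a)) *
            Real.exp (-(ε / 4 * (ε * k / 2))) := by
          rw [Finset.sum_mul]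
          refine Finset.sum_congr rfl fun a _ => ?_
          rw [← Real.exp_add, hE]
          ring_nf
      _ ≤ (2 * Real.exp ((ε / 4) ^ 2 / 2)) ^ (2 * k) * Real.exp (-(ε / 4 * (ε * k / 2))) := by
          gcongr
          rw [← hS]
          exact sum_exp_imbalance_le hU _
      _ = 4 ^ k * (Real.exp (↑(2 * k) * ((ε / 4) ^ 2 / 2)) *
            Real.exp (-(ε / 4 * (ε * k / 2)))) := by
          rw [mul_pow, ← Real.exp_nat_mul, pow_mul]
          norm_num [mul_assoc]
      _ = _ := by
          rw [← Real.exp_add]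
          push_cast
          ring_nf
  calc ∑ a ∈ S.powersetCard k, f a * imbalance U a * c
      ≤ ∑ a ∈ S.powersetCard k, (ε * k / 2 * (f a * c) + m * (2 * k) * E a) :=
        Finset.sum_le_sum h2
    _ = ε / 2 * (k * (∑ a ∈ S.powersetCard k, f a) * c)
          + m * (2 * k) * ∑ a ∈ S.powersetCard k, E a := by
        rw [Finset.sum_add_distrib, ← Finset.mul_sum, ← Finset.mul_sum, ← Finset.sum_mul]
        ring
    _ ≤ _ := by gcongr

lemma card_powersetCard_filter_notMem {k : ℕ} {S : Finset α} {i : α} (hi : i ∈ S)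
    (hS : S.card = 2 * k) :
    ((S.powersetCard k).filter (i ∉ ·)).card = (2 * k - 1).choose k := by
  have : (S.powersetCard k).filter (i ∉ ·) = (S.erase i).powersetCard k := by
    ext a
    simp only [Finset.mem_filter, Finset.mem_powersetCard, Finset.subset_erase]
    tauto
  rw [this, Finset.card_powersetCard, Finset.card_erase_of_mem hi, hS]

lemma card_powersetCard_filter_mem {k : ℕ} (hk : 0 < k) {S : Finset α} {i : α} (hi : i ∈ S)
    (hS : S.card = 2 * k) :
    ((S.powersetCard k).filter (i ∈ ·)).card = (2 * k - 1).choose k := by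
  have h := Finset.card_filter_add_card_filter_not (s := S.powersetCard k) (i ∈ ·)
  rw [card_powersetCard_filter_notMem hi hS, Finset.card_powersetCard, hS] at h
  obtain ⟨j, rfl⟩ : ∃ j, k = j + 1 := ⟨k - 1, by omega⟩
  have h1 : (2 * (j + 1) - 1).choose j = (2 * (j + 1) - 1).choose (j + 1) :=
    Nat.choose_symm_of_eq_add (by omega)
  have h2 : (2 * (j + 1)).choose (j + 1) =
      (2 * (j + 1) - 1).choose j + (2 * (j + 1) - 1).choose (j + 1) := by
    rw [show 2 * (j + 1) = (2 * (j + 1) - 1) + 1 by omega]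
    exact Nat.choose_succ_succ _ _
  omega

lemma four_pow_le_mul_choose {k : ℕ} (hk : 0 < k) : 4 ^ k ≤ 4 * k * (2 * k - 1).choose k := by
  have h := Nat.four_pow_le_two_mul_self_mul_centralBinom k hk
  obtain ⟨j, rfl⟩ : ∃ j, k = j + 1 := ⟨k - 1, by omega⟩
  have h1 : (2 * (j + 1) - 1).choose j = (2 * (j + 1) - 1).choose (j + 1) :=
    Nat.choose_symm_of_eq_add (by omega)
  have h2 : (2 * (j + 1)).choose (j + 1) =
      (2 * (j + 1) - 1).choose j + (2 * (j + 1) - 1).choose (j + 1) := by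
    rw [show 2 * (j + 1) = (2 * (j + 1) - 1) + 1 by omega]
    exact Nat.choose_succ_succ _ _
  rw [Nat.centralBinom, h2, h1] at h
  calc _ ≤ _ := h
    _ = _ := by ring

lemma card_filter_between {β : Type*} [Fintype β] [DecidableEq β] {a c : Finset β} (hac : a ⊆ c)
    {m : ℕ} (hm : a.card ≤ m) :
    (Finset.univ.filter fun S : Finset β => a ⊆ S ∧ S ⊆ c ∧ S.card = m).card =
      (c.card - a.card).choose (m - a.card) := by
  rw [← Finset.card_sdiff_of_subset hac, ← Finset.card_powersetCard]
  refine Finset.card_nbij' (· \ a) (· ∪ a) ?_ ?_ ?_ ?_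
  · intro S hS
    simp only [Finset.coe_filter, Finset.mem_univ, true_and, Set.mem_ofPred_eq] at hS
    simp only [Finset.mem_coe, Finset.mem_powersetCard]
    refine ⟨Finset.sdiff_subset_sdiff hS.2.1 le_rfl, ?_⟩
    rw [Finset.card_sdiff_of_subset hS.1, hS.2.2]
  · intro S hS
    simp only [Finset.mem_coe, Finset.mem_powersetCard, Finset.subset_sdiff] at hS
    simp only [Finset.coe_filter, Finset.mem_univ, true_and, Set.mem_ofPred_eq]
    refine ⟨Finset.subset_union_right, Finset.union_subset hS.1.1 hac, ?_⟩
    rw [Finset.card_union_of_disjoint hS.1.2]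
    omega
  · intro S hS
    simp only [Finset.coe_filter, Finset.mem_univ, true_and, Set.mem_ofPred_eq] at hS
    exact Finset.sdiff_union_of_subset hS.1
  · intro S hS
    simp only [Finset.mem_coe, Finset.mem_powersetCard, Finset.subset_sdiff] at hS
    exact Finset.union_sdiff_cancel_right hS.1.2

end Slices

/-! ### Double counting over pointed 2k-sets -/

section PointedSets

/-- The pairs `(i, S)` with `i ∈ S` and `|S| = 2 k`. -/
def pointedSets (n k : ℕ) : Finset (Fin n × Finset (Fin n)) :=
  Finset.univ.filter fun p => p.1 ∈ p.2 ∧ p.2.card = 2 * k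

/-- The set meeting `p.2` exactly in the point `p.1` and covering everything else. -/
def oppositePointed {n : ℕ} (p : Fin n × Finset (Fin n)) : Fin n × Finset (Fin n) :=
  (p.1, insert p.1 p.2ᶜ)

variable {n k : ℕ}

lemma oppositePointed_mem (hn : n + 1 = 4 * k) {p : Fin n × Finset (Fin n)}
    (hp : p ∈ pointedSets n k) : oppositePointed p ∈ pointedSets n k := by
  simp only [pointedSets, Finset.mem_filter, Finset.mem_univ, true_and, oppositePointed] at hp ⊢
  refine ⟨Finset.mem_insert_self _ _, ?_⟩
  rw [Finset.card_insert_of_notMem (by simpa using hp.1), Finset.card_compl, Fintype.card_fin]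
  omega

lemma oppositePointed_oppositePointed {p : Fin n × Finset (Fin n)} (hp : p.1 ∈ p.2) :
    oppositePointed (oppositePointed p) = p := by
  obtain ⟨i, S⟩ := p
  simp only [oppositePointed, Prod.mk.injEq, true_and]
  ext j
  by_cases h : j = i
  · subst h; simpa using hp
  · simp [h]

lemma sum_oppositePointed (hn : n + 1 = 4 * k) (h : Fin n × Finset (Fin n) → ℝ) :
    ∑ p ∈ pointedSets n k, h (oppositePointed p) = ∑ p ∈ pointedSets n k, h p := by
  refine Finset.sum_nbij' oppositePointed oppositePointed
    (fun p hp => oppositePointed_mem hn hp) (fun p hp => oppositePointed_mem hn hp)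
    ?_ ?_ fun _ _ => rfl <;>
  · intro p hp
    exact oppositePointed_oppositePointed (Finset.mem_filter.1 hp).2.1

lemma sum_pointedSets (h : Fin n → Finset (Fin n) → ℝ) :
    ∑ p ∈ pointedSets n k, h p.1 p.2 =
      ∑ S ∈ Finset.univ.powersetCard (2 * k), ∑ i ∈ S, h i S := by
  rw [Finset.sum_sigma']
  refine Finset.sum_nbij' (fun p => ⟨p.2, p.1⟩) (fun q => (q.2, q.1)) ?_ ?_ ?_ ?_ ?_ <;>
  simp +contextual [pointedSets, Finset.mem_powersetCard]

lemma card_filter_prod_eq_sum {α β : Type*} [Fintype α] [Fintype β] (P : α × β → Prop)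
    [DecidablePred P] :
    (Finset.univ.filter P).card = ∑ i, (Finset.univ.filter fun S => P (i, S)).card := by
  simp_rw [Finset.card_filter]
  exact Fintype.sum_prod_type _

/-- The point i is any of the 2k - 1 points outside a ∪ b, and then S lies between a ∪ {i} and bᶜ.
-/
lemma card_filter_avoiding (hn : n + 1 = 4 * k)
    {q : Finset (Fin n) × Finset (Fin n)} (hq : q ∈ disjointPairs n k) :
    ((pointedSets n k).filter fun p => q ∈
      ((p.2.powersetCard k).filter (p.1 ∉ ·)) ×ˢ
        (((oppositePointed p).2.powersetCard k).filter (p.1 ∉ ·))).card =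
      (2 * k - 1) * (2 * k - 2).choose (k - 1) := by
  obtain ⟨a, b⟩ := q
  simp only [disjointPairs, pairsMeetingIn, Finset.mem_filter, Finset.mem_univ, true_and,
    Finset.card_eq_zero] at hq
  obtain ⟨ha, hb, hab⟩ := hq
  have hdisj : Disjoint a b := Finset.disjoint_iff_inter_eq_empty.2 hab
  rw [pointedSets, Finset.filter_filter, card_filter_prod_eq_sum]
  have hfib : ∀ i : Fin n, (Finset.univ.filter fun S : Finset (Fin n) =>
      (i ∈ S ∧ S.card = 2 * k) ∧ (a, b) ∈ ((S.powersetCard k).filter (i ∉ ·)) ×ˢ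
        (((oppositePointed (i, S)).2.powersetCard k).filter (i ∉ ·))).card =
      if i ∈ (a ∪ b)ᶜ then (2 * k - 2).choose (k - 1) else 0 := by
    intro i
    split_ifs with hi
    · have hia : i ∉ a := by simp at hi; tauto
      have hib : i ∉ b := by simp at hi; tauto
      have hsub : insert i a ⊆ bᶜ := by
        rw [Finset.insert_subset_iff]
        exact ⟨by simpa using hib, Finset.subset_compl_iff_disjoint_right.2 hdisj⟩
      have hc : (insert i a).card = k + 1 := by rw [Finset.card_insert_of_notMem hia, ha]
      have := card_filter_between hsub (m := 2 * k) (by omega)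
      rw [hc, Finset.card_compl, hb, Fintype.card_fin,
        show n - k - (k + 1) = 2 * k - 2 by omega, show 2 * k - (k + 1) = k - 1 by omega] at this
      rw [← this]
      congr 1
      ext S
      simp only [oppositePointed, Finset.mem_filter, Finset.mem_univ, true_and,
        Finset.mem_product, Finset.mem_powersetCard, ha, hb, and_true, hia, hib,
        not_false_eq_true, Finset.insert_subset_iff, Finset.subset_insert_iff_of_notMem hib]
      rw [Finset.subset_compl_comm]
      tauto
    · rw [Finset.card_eq_zero, Finset.filter_eq_empty_iff]
      intro S _ h
      simp only [Finset.mem_product, Finset.mem_filter] at h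
      simp at hi
      tauto
  rw [Finset.sum_congr rfl fun i _ => hfib i, Finset.sum_ite_mem, Finset.univ_inter,
    Finset.sum_const, Finset.card_compl, Finset.card_union_of_disjoint hdisj, ha, hb,
    Fintype.card_fin, smul_eq_mul, show n - (k + k) = 2 * k - 1 by omega]

/-- The point i must be the common point of a and b, and then S lies between a and the complement of
b \ {i}. -/
lemma card_filter_containing (hn : n + 1 = 4 * k)
    {q : Finset (Fin n) × Finset (Fin n)} (hq : q ∈ barelyIntersectingPairs n k) :
    ((pointedSets n k).filter fun p => q ∈
      ((p.2.powersetCard k).filter (p.1 ∈ ·)) ×ˢ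
        (((oppositePointed p).2.powersetCard k).filter (p.1 ∈ ·))).card =
      (2 * k).choose k := by
  obtain ⟨a, b⟩ := q
  simp only [barelyIntersectingPairs, pairsMeetingIn, Finset.mem_filter, Finset.mem_univ, true_and,
    Finset.card_eq_one] at hq
  obtain ⟨ha, hb, j, hab⟩ := hq
  have hj : j ∈ a ∩ b := by simp [hab]
  have hja := (Finset.mem_inter.1 hj).1
  have hjb := (Finset.mem_inter.1 hj).2
  rw [pointedSets, Finset.filter_filter, card_filter_prod_eq_sum]
  have hfib : ∀ i : Fin n, (Finset.univ.filter fun S : Finset (Fin n) =>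
      (i ∈ S ∧ S.card = 2 * k) ∧ (a, b) ∈ ((S.powersetCard k).filter (i ∈ ·)) ×ˢ
        (((oppositePointed (i, S)).2.powersetCard k).filter (i ∈ ·))).card =
      if i = j then (2 * k).choose k else 0 := by
    intro i
    split_ifs with hi
    · subst hi
      have hsub : a ⊆ (b.erase i)ᶜ := by
        intro x hxa
        simp only [Finset.mem_compl, Finset.mem_erase, not_and]
        intro hxi hxb
        have : x ∈ a ∩ b := Finset.mem_inter.2 ⟨hxa, hxb⟩
        rw [hab, Finset.mem_singleton] at this
        exact hxi this
      have hk : 0 < k := ha ▸ Finset.card_pos.2 ⟨i, hja⟩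
      have := card_filter_between hsub (m := 2 * k) (by omega)
      rw [ha, Finset.card_compl, Finset.card_erase_of_mem hjb, hb, Fintype.card_fin,
        show n - (k - 1) - k = 2 * k by omega, show 2 * k - k = k by omega] at this
      rw [← this]
      congr 1
      ext S
      simp only [oppositePointed, Finset.mem_filter, Finset.mem_univ, true_and,
        Finset.mem_product, Finset.mem_powersetCard, ha, hb, and_true, hja, hjb,
        Finset.subset_insert_iff]
      rw [Finset.subset_compl_comm]
      have : a ⊆ S → i ∈ S := fun h => h hja
      tauto
    · rw [Finset.card_eq_zero, Finset.filter_eq_empty_iff]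
      intro S _ h
      simp only [Finset.mem_product, Finset.mem_filter] at h
      have : i ∈ a ∩ b := Finset.mem_inter.2 ⟨h.2.1.2, h.2.2.2⟩
      rw [hab, Finset.mem_singleton] at this
      exact hi this
  rw [Finset.sum_congr rfl fun i _ => hfib i]
  simp

lemma sum_avoidingSum_mul_avoidingSum (hn : n + 1 = 4 * k)
    (f g : Finset (Fin n) → ℝ) :
    ∑ p ∈ pointedSets n k, avoidingSum f k p.1 p.2 * avoidingSum g k p.1 (oppositePointed p).2 =
      ((2 * k - 1) * (2 * k - 2).choose (k - 1) : ℕ) *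
        ∑ q ∈ disjointPairs n k, f q.1 * g q.2 := by
  simp_rw [avoidingSum, Finset.sum_mul_sum, ← Finset.sum_product']
  rw [Finset.sum_comm' (t' := disjointPairs n k) (s' := fun q => (pointedSets n k).filter fun p =>
    q ∈ ((p.2.powersetCard k).filter (p.1 ∉ ·)) ×ˢ
        (((oppositePointed p).2.powersetCard k).filter (p.1 ∉ ·))), Finset.mul_sum]
  · refine Finset.sum_congr rfl fun q hq => ?_
    rw [Finset.sum_const, card_filter_avoiding hn hq, nsmul_eq_mul]
  · rintro p ⟨a, b⟩
    rw [Finset.mem_filter]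
    refine ⟨fun h => ⟨h, ?_⟩, fun h => h.1⟩
    obtain ⟨-, h⟩ := h
    simp only [Finset.mem_product, Finset.mem_filter, Finset.mem_powersetCard,
      oppositePointed] at h
    obtain ⟨⟨⟨haS, hac⟩, hia⟩, ⟨hbS, hbc⟩, hib⟩ := h
    rw [Finset.subset_insert_iff_of_notMem hib] at hbS
    simp only [disjointPairs, pairsMeetingIn, Finset.mem_filter, Finset.mem_univ, true_and,
      Finset.card_eq_zero]
    refine ⟨hac, hbc, Finset.disjoint_iff_inter_eq_empty.1 ?_⟩
    exact Finset.disjoint_of_subset_left haS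
      (Finset.disjoint_of_subset_right hbS disjoint_compl_right)

lemma sum_containingSum_mul_containingSum (hn : n + 1 = 4 * k) (f g : Finset (Fin n) → ℝ) :
    ∑ p ∈ pointedSets n k,
        containingSum f k p.1 p.2 * containingSum g k p.1 (oppositePointed p).2 =
      ((2 * k).choose k : ℕ) * ∑ q ∈ barelyIntersectingPairs n k, f q.1 * g q.2 := by
  simp_rw [containingSum, Finset.sum_mul_sum, ← Finset.sum_product']
  rw [Finset.sum_comm' (t' := barelyIntersectingPairs n k)
    (s' := fun q => (pointedSets n k).filter fun p =>
    q ∈ ((p.2.powersetCard k).filter (p.1 ∈ ·)) ×ˢ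
        (((oppositePointed p).2.powersetCard k).filter (p.1 ∈ ·))), Finset.mul_sum]
  · refine Finset.sum_congr rfl fun q hq => ?_
    rw [Finset.sum_const, card_filter_containing hn hq, nsmul_eq_mul]
  · rintro p ⟨a, b⟩
    rw [Finset.mem_filter]
    refine ⟨fun h => ⟨h, ?_⟩, fun h => h.1⟩
    obtain ⟨-, h⟩ := h
    simp only [Finset.mem_product, Finset.mem_filter, Finset.mem_powersetCard,
      oppositePointed] at h
    obtain ⟨⟨⟨haS, hac⟩, hia⟩, ⟨hbS, hbc⟩, hib⟩ := h
    simp only [barelyIntersectingPairs, pairsMeetingIn, Finset.mem_filter, Finset.mem_univ,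
      true_and, Finset.card_eq_one]
    refine ⟨hac, hbc, p.1, Finset.eq_singleton_iff_unique_mem.2
      ⟨Finset.mem_inter.2 ⟨hia, hib⟩, fun x hx => ?_⟩⟩
    obtain ⟨hxa, hxb⟩ := Finset.mem_inter.1 hx
    have h1 := haS hxa
    have h2 := hbS hxb
    simp only [Finset.mem_insert, Finset.mem_compl] at h2
    tauto

lemma avoidingSum_oppositePointed (g : Finset (Fin n) → ℝ) {p : Fin n × Finset (Fin n)}
    (hp : p.1 ∈ p.2) :
    avoidingSum g k p.1 (oppositePointed p).2 = ∑ b ∈ p.2ᶜ.powersetCard k, g b := by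
  unfold avoidingSum
  refine Finset.sum_congr ?_ fun _ _ => rfl
  ext b
  simp only [oppositePointed, Finset.mem_filter, Finset.mem_powersetCard]
  constructor
  · rintro ⟨⟨h1, h2⟩, h3⟩
    exact ⟨(Finset.subset_insert_iff_of_notMem h3).1 h1, h2⟩
  · rintro ⟨h1, h2⟩
    exact ⟨⟨h1.trans (Finset.subset_insert _ _), h2⟩, fun h => by simpa [hp] using h1 h⟩

lemma card_powersetCard_compl (hn : n + 1 = 4 * k) {S : Finset (Fin n)} (hS : S.card = 2 * k) :
    (Sᶜ.powersetCard k).card = (2 * k - 1).choose k := by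
  rw [Finset.card_powersetCard, Finset.card_compl, hS, Fintype.card_fin,
    show n - 2 * k = 2 * k - 1 by omega]

lemma sum_posPart_mul_avoidingSum_le (hn : n + 1 = 4 * k)
    {f g : Finset (Fin n) → ℝ} (hf : ∀ a, 0 ≤ f a) (hg : ∀ b, 0 ≤ g b) {M ε : ℝ} (hM : 0 ≤ M)
    (hfg : ∀ q ∈ disjointPairs n k, f q.1 * g q.2 ≤ M) (hε : 0 ≤ ε) :
    ∑ p ∈ pointedSets n k, max (avoidingSum f k p.1 p.2 - containingSum f k p.1 p.2) 0 *
        avoidingSum g k p.1 (oppositePointed p).2 ≤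
      ε / 2 * ∑ p ∈ pointedSets n k,
          avoidingSum f k p.1 p.2 * avoidingSum g k p.1 (oppositePointed p).2
        + (pointedSets n k).card *
          (M * (2 * k - 1).choose k * (4 ^ k * Real.exp (-(ε ^ 2 * k / 16)))) := by
  have hrepl : ∀ F : Fin n → Finset (Fin n) → ℝ, ∑ p ∈ pointedSets n k, F p.1 p.2 *
      avoidingSum g k p.1 (oppositePointed p).2 =
      ∑ S ∈ Finset.univ.powersetCard (2 * k), ∑ i ∈ S,
        F i S * ∑ b ∈ Sᶜ.powersetCard k, g b := by
    intro F
    rw [← sum_pointedSets fun i S => F i S * ∑ b ∈ Sᶜ.powersetCard k, g b]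
    refine Finset.sum_congr rfl fun p hp => ?_
    rw [avoidingSum_oppositePointed g (Finset.mem_filter.1 hp).2.1]
  have hcard : ((pointedSets n k).card : ℝ) =
      ∑ S ∈ (Finset.univ : Finset (Fin n)).powersetCard (2 * k), (2 * k : ℝ) := by
    rw [Finset.card_eq_sum_ones]
    push_cast
    rw [sum_pointedSets (n := n) (k := k) fun _ _ => (1 : ℝ)]
    refine Finset.sum_congr rfl fun S hS => ?_
    simp [(Finset.mem_powersetCard.1 hS).2]
  rw [hrepl fun i S => max (avoidingSum f k i S - containingSum f k i S) 0,
    hrepl fun i S => avoidingSum f k i S, hcard, Finset.mul_sum, Finset.sum_mul,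
    ← Finset.sum_add_distrib]
  refine Finset.sum_le_sum fun S hS => ?_
  have hSc := (Finset.mem_powersetCard.1 hS).2
  -- Each a is disjoint from all C(2k - 1, k) of the k-subsets b of Sᶜ, and each product f(a) g(b)
  -- is at most M.
  refine (sum_posPart_avoidingSum_sub_containingSum_le hf hSc
    (Finset.sum_nonneg fun b _ => hg b) (m := M * (2 * k - 1).choose k) (by positivity)
    (fun a ha => ?_) hε).trans_eq (by ring)
  rw [Finset.mul_sum, ← card_powersetCard_compl hn hSc, mul_comm M, ← nsmul_eq_mul]
  refine Finset.sum_le_card_nsmul _ _ _ fun b hb => hfg (a, b) ?_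
  obtain ⟨haS, hac⟩ := Finset.mem_powersetCard.1 ha
  obtain ⟨hbS, hbc⟩ := Finset.mem_powersetCard.1 hb
  simp only [disjointPairs, pairsMeetingIn, Finset.mem_filter, Finset.mem_univ, true_and,
    Finset.card_eq_zero]
  exact ⟨hac, hbc, Finset.disjoint_iff_inter_eq_empty.1 (Finset.disjoint_of_subset_left haS
    (Finset.disjoint_of_subset_right hbS disjoint_compl_right))⟩

end PointedSets

/-! ### Comparison of the two averages -/

section Comparison

/-- The form matters: each positive part is multiplied by an avoiding factor (index 0), which is
independent of i when seen from the other side. -/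
lemma mul_sub_mul_le_posPart {x₀ x₁ y₀ y₁ : ℝ} (hx₁ : 0 ≤ x₁)
    (hy₀ : 0 ≤ y₀) (hy₁ : 0 ≤ y₁) :
    x₀ * y₀ - x₁ * y₁ ≤ max (x₀ - x₁) 0 * y₀ + max (y₀ - y₁) 0 * x₀ := by
  rcases le_total x₀ x₁ with hx | hx <;> rcases le_total y₀ y₁ with hy | hy
  · rw [max_eq_right (by linarith), max_eq_right (by linarith)]; nlinarith
  · rw [max_eq_right (by linarith), max_eq_left (by linarith)]; nlinarith
  · rw [max_eq_left (by linarith), max_eq_right (by linarith)]; nlinarith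
  · rw [max_eq_left (by linarith), max_eq_left (by linarith)]; nlinarith

variable {n k : ℕ}

lemma swap_mem_disjointPairs {a b : Finset (Fin n)} (h : (a, b) ∈ disjointPairs n k) :
    (b, a) ∈ disjointPairs n k := by
  simp only [disjointPairs, pairsMeetingIn, Finset.mem_filter, Finset.mem_univ, true_and] at h ⊢
  exact ⟨h.2.1, h.1, by rw [Finset.inter_comm]; exact h.2.2⟩

/-- The involution `oppositePointed` exchanges the roles of f and g. -/
lemma sum_mul_avoidingSum_oppositePointed (hn : n + 1 = 4 * k) (f : Finset (Fin n) → ℝ)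
    (φ : Fin n → Finset (Fin n) → ℝ) :
    ∑ p ∈ pointedSets n k, φ p.1 (oppositePointed p).2 * avoidingSum f k p.1 p.2 =
      ∑ p ∈ pointedSets n k, φ p.1 p.2 * avoidingSum f k p.1 (oppositePointed p).2 := by
  rw [← sum_oppositePointed hn]
  refine Finset.sum_congr rfl fun p hp => ?_
  rw [oppositePointed_oppositePointed (Finset.mem_filter.1 hp).2.1]
  rfl

/-- The comparison of the two classes, before normalization. -/
lemma sum_avoiding_sub_sum_containing_le (hn : n + 1 = 4 * k)
    {f g : Finset (Fin n) → ℝ} (hf : ∀ a, 0 ≤ f a) (hg : ∀ b, 0 ≤ g b) {M ε : ℝ} (hM : 0 ≤ M)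
    (hfg : ∀ q ∈ disjointPairs n k, f q.1 * g q.2 ≤ M) (hε : 0 ≤ ε) :
    (1 - ε) * ∑ p ∈ pointedSets n k,
          avoidingSum f k p.1 p.2 * avoidingSum g k p.1 (oppositePointed p).2
        - ∑ p ∈ pointedSets n k,
          containingSum f k p.1 p.2 * containingSum g k p.1 (oppositePointed p).2 ≤
      2 * ((pointedSets n k).card *
          (M * (2 * k - 1).choose k * (4 ^ k * Real.exp (-(ε ^ 2 * k / 16))))) := by
  have h1 := sum_posPart_mul_avoidingSum_le hn hf hg hM hfg hε
  have h2 := sum_posPart_mul_avoidingSum_le hn hg hf hM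
    (fun q hq => by rw [mul_comm]; exact hfg (q.2, q.1) (swap_mem_disjointPairs hq)) hε
  have h3 : ∑ p ∈ pointedSets n k,
      avoidingSum g k p.1 p.2 * avoidingSum f k p.1 (oppositePointed p).2 =
      ∑ p ∈ pointedSets n k,
        avoidingSum f k p.1 p.2 * avoidingSum g k p.1 (oppositePointed p).2 := by
    rw [← sum_mul_avoidingSum_oppositePointed hn f (avoidingSum g k)]
    exact Finset.sum_congr rfl fun _ _ => mul_comm _ _
  rw [h3, ← sum_mul_avoidingSum_oppositePointed hn f
    fun i S => max (avoidingSum g k i S - containingSum g k i S) 0] at h2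
  have h4 : ∀ p ∈ pointedSets n k, _ ≤ _ := fun p _ =>
    mul_sub_mul_le_posPart (x₀ := avoidingSum f k p.1 p.2) (x₁ := containingSum f k p.1 p.2)
      (y₀ := avoidingSum g k p.1 (oppositePointed p).2)
      (y₁ := containingSum g k p.1 (oppositePointed p).2)
      (Finset.sum_nonneg fun a _ => hf a)
      (Finset.sum_nonneg fun a _ => hg a) (Finset.sum_nonneg fun a _ => hg a)
  have h5 := Finset.sum_le_sum h4
  rw [Finset.sum_sub_distrib, Finset.sum_add_distrib] at h5
  linarith

/-- This is the double count with f = g = 1. The barely intersecting pairs give the same total,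
since half of the k-subsets of S contain i. -/
lemma weighted_card_disjointPairs (hn : n + 1 = 4 * k) :
    (((2 * k - 1) * (2 * k - 2).choose (k - 1) : ℕ) : ℝ) * (disjointPairs n k).card =
      (pointedSets n k).card * ((2 * k - 1).choose k : ℝ) ^ 2 := by
  have h := sum_avoidingSum_mul_avoidingSum hn (fun _ => 1) (fun _ => 1)
  simp only [mul_one, Finset.sum_const, nsmul_eq_mul] at h
  rw [← h, ← nsmul_eq_mul, ← Finset.sum_const]
  refine Finset.sum_congr rfl fun p hp => ?_
  have hp' := oppositePointed_mem hn hp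
  obtain ⟨-, hp1, hp2⟩ := Finset.mem_filter.1 hp
  obtain ⟨-, hq1, hq2⟩ := Finset.mem_filter.1 hp'
  simp only [avoidingSum, Finset.sum_const, nsmul_eq_mul, mul_one]
  rw [card_powersetCard_filter_notMem hp1 hp2,
    card_powersetCard_filter_notMem (i := p.1) hq1 hq2, sq]

lemma weighted_card_barelyIntersectingPairs (hn : n + 1 = 4 * k) :
    (((2 * k).choose k : ℕ) : ℝ) * (barelyIntersectingPairs n k).card =
      (pointedSets n k).card * ((2 * k - 1).choose k : ℝ) ^ 2 := by
  have hk : 0 < k := by omega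
  have h := sum_containingSum_mul_containingSum hn (fun _ => 1) (fun _ => 1)
  simp only [mul_one, Finset.sum_const, nsmul_eq_mul] at h
  rw [← h, ← nsmul_eq_mul, ← Finset.sum_const]
  refine Finset.sum_congr rfl fun p hp => ?_
  have hp' := oppositePointed_mem hn hp
  obtain ⟨-, hp1, hp2⟩ := Finset.mem_filter.1 hp
  obtain ⟨-, hq1, hq2⟩ := Finset.mem_filter.1 hp'
  simp only [containingSum, Finset.sum_const, nsmul_eq_mul, mul_one]
  rw [card_powersetCard_filter_mem hk hp1 hp2,
    card_powersetCard_filter_mem hk (i := p.1) hq1 hq2, sq]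

lemma pointedSets_nonempty (hn : n + 1 = 4 * k) : (pointedSets n k).Nonempty := by
  obtain ⟨S, -, hS⟩ := Finset.exists_subset_card_eq (s := (Finset.univ : Finset (Fin n)))
    (n := 2 * k) (by rw [Finset.card_univ, Fintype.card_fin]; omega)
  obtain ⟨i, hi⟩ : S.Nonempty := Finset.card_pos.1 (by omega)
  exact ⟨(i, S), by simp [pointedSets, hi, hS]⟩

lemma average_disjointPairs_sub_le (hn : n + 1 = 4 * k)
    {f g : Finset (Fin n) → ℝ} (hf : ∀ a, 0 ≤ f a) (hg : ∀ b, 0 ≤ g b) {M ε : ℝ} (hM : 0 ≤ M)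
    (hfg : ∀ q ∈ disjointPairs n k, f q.1 * g q.2 ≤ M) (hε : 0 ≤ ε) :
    (1 - ε) * ((∑ q ∈ disjointPairs n k, f q.1 * g q.2) / (disjointPairs n k).card)
        - (∑ q ∈ barelyIntersectingPairs n k, f q.1 * g q.2) /
          (barelyIntersectingPairs n k).card ≤
      M * (8 * k * Real.exp (-(ε ^ 2 * k / 16))) := by
  have hk : 0 < k := by omega
  have h := sum_avoiding_sub_sum_containing_le hn hf hg hM hfg hε
  rw [sum_avoidingSum_mul_avoidingSum hn, sum_containingSum_mul_containingSum hn] at h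
  have hA := weighted_card_disjointPairs hn
  have hB := weighted_card_barelyIntersectingPairs hn
  have hP : (0 : ℝ) < (pointedSets n k).card := by
    exact_mod_cast Finset.card_pos.2 (pointedSets_nonempty hn)
  have hK : (0 : ℝ) < (2 * k - 1).choose k := by
    exact_mod_cast Nat.choose_pos (by omega)
  have h4 : (4 : ℝ) ^ k ≤ 4 * k * (2 * k - 1).choose k := by
    exact_mod_cast four_pow_le_mul_choose hk
  generalize (((2 * k - 1) * (2 * k - 2).choose (k - 1) : ℕ) : ℝ) = wA at h hA
  generalize (((2 * k).choose k : ℕ) : ℝ) = wB at h hB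
  generalize ((pointedSets n k).card : ℝ) = P at h hA hB hP
  generalize ((2 * k - 1).choose k : ℝ) = K at h hA hB hK h4
  generalize ((disjointPairs n k).card : ℝ) = NA at h hA ⊢
  generalize ((barelyIntersectingPairs n k).card : ℝ) = NB at h hB ⊢
  have hW : 0 < P * K ^ 2 := by positivity
  have hNA : NA ≠ 0 := by rintro rfl; simp at hA; rcases hA with hA | hA <;> simp_all
  have hNB : NB ≠ 0 := by rintro rfl; simp at hB; rcases hB with hB | hB <;> simp_all
  -- Both averages acquire the common denominator P K².
  have e1 : ∀ s : ℝ, s / NA = wA * s / (P * K ^ 2) := by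
    intro s; rw [← hA]; have : wA ≠ 0 := by rintro rfl; simp at hA; rcases hA <;> simp_all
    field_simp
  have e2 : ∀ s : ℝ, s / NB = wB * s / (P * K ^ 2) := by
    intro s; rw [← hB]; have : wB ≠ 0 := by rintro rfl; simp at hB; rcases hB <;> simp_all
    field_simp
  rw [e1, e2, ← mul_div_assoc, ← sub_div, div_le_iff₀ hW]
  refine h.trans ?_
  have hE := Real.exp_pos (-(ε ^ 2 * k / 16))
  generalize Real.exp (-(ε ^ 2 * k / 16)) = E at hE
  calc 2 * (P * (M * K * (4 ^ k * E))) ≤ 2 * (P * (M * K * (4 * k * K * E))) := by gcongr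
    _ = M * (8 * k * E) * (P * K ^ 2) := by ring

end Comparison

/-! ### Conditional expectations as finite averages, and the final bound -/

section Conditional

lemma integral_uniformOn_finset {Ω : Type*} [Fintype Ω] [MeasurableSpace Ω]
    [MeasurableSingletonClass Ω] (S : Finset Ω) (X : Ω → ℝ) :
    ∫ p, X p ∂(uniformOn (S : Set Ω)) = (∑ p ∈ S, X p) / S.card := by
  rw [uniformOn, ProbabilityTheory.cond, integral_smul_measure,
    setIntegral_finset _ Integrable.of_finite.integrableOn]
  simp [Measure.count_apply_finset, Measure.real, div_eq_inv_mul]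

lemma le_maxNormOn {n : ℕ} (X : Finset (Fin n) × Finset (Fin n) → ℝ)
    {S : Finset (Finset (Fin n) × Finset (Fin n))} {p : Finset (Fin n) × Finset (Fin n)}
    (hp : p ∈ S) : X p ≤ maxNormOn X S :=
  (le_abs_self _).trans (norm_le_pi_norm (fun p : S => X p) ⟨p, hp⟩)

end Conditional

theorem lemma1 :
    ∃ C : ℝ, ∀ (n ℓ : ℕ), n % 4 = 3 → ℓ = (n + 1) / 4 →
      ∀ μ : Measure (Finset (Fin n) × Finset (Fin n)), IsUniformOnEachClass n ℓ μ →
      ∀ f g : Finset (Fin n) → ℝ, (∀ a, 0 ≤ f a) → (∀ b, 0 ≤ g b) →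
      ∀ X : Finset (Fin n) × Finset (Fin n) → ℝ, (∀ a b, X (a, b) = f a * g b) →
      ∀ ε : ℝ, 0 < ε → ε < 1 →
        (1 - ε) * expectGiven μ X (disjointPairs n ℓ)
            - expectGiven μ X (barelyIntersectingPairs n ℓ) ≤
          maxNormOn X (disjointPairs n ℓ ∪ barelyIntersectingPairs n ℓ) *
            (2 : ℝ) ^ (-(ε ^ 2 / (16 * Real.log 2)) * (ℓ : ℝ) + C * Real.logb 2 (ℓ : ℝ)) := by
  -- C = 4 works because 8k ≤ k⁴ for k ≥ 2.
  refine ⟨4, fun n k hmod hk μ hμ f g hf hg X hX ε hε hε1 => ?_⟩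
  have hn : n + 1 = 4 * k := by omega
  have hk0 : 0 < k := by omega
  have hkR : (0 : ℝ) < k := by exact_mod_cast hk0
  set M := maxNormOn X (disjointPairs n k ∪ barelyIntersectingPairs n k) with hMdef
  have hM : 0 ≤ M := norm_nonneg _
  have hXfg : X = fun q => f q.1 * g q.2 := funext fun q => hX q.1 q.2
  have hfg : ∀ q ∈ disjointPairs n k, f q.1 * g q.2 ≤ M := fun q hq => by
    rw [← hX]
    exact le_maxNormOn X (Finset.mem_union_left _ hq)
  have hbound : (2 : ℝ) ^ (-(ε ^ 2 / (16 * Real.log 2)) * (k : ℝ) + 4 * Real.logb 2 (k : ℝ)) =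
      k ^ 4 * Real.exp (-(ε ^ 2 * k / 16)) := by
    have hlog : Real.log 2 ≠ 0 := (Real.log_pos one_lt_two).ne'
    rw [Real.rpow_add two_pos, mul_comm, mul_comm 4, Real.rpow_mul two_pos.le,
      Real.rpow_logb two_pos (by norm_num) hkR, Real.rpow_def_of_pos two_pos]
    congr 1
    · exact_mod_cast Real.rpow_natCast (k : ℝ) 4
    · congr 1
      field_simp
  rw [hbound, expectGiven, expectGiven, hμ.cond_disjoint, hμ.cond_barelyIntersecting,
    integral_uniformOn_finset, integral_uniformOn_finset, hXfg]
  -- For k = 1 the factor k⁴ is 1 and cannot absorb the 8; there 1 - ε ≤ exp(-ε²/16) suffices.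
  rcases Nat.lt_or_ge k 2 with h2 | h2
  · obtain rfl : k = 1 := by omega
    have hA : (∑ q ∈ disjointPairs n 1, f q.1 * g q.2) / (disjointPairs n 1).card ≤ M := by
      refine div_le_of_le_mul₀ (Nat.cast_nonneg _) hM ?_
      rw [mul_comm, ← nsmul_eq_mul]
      exact Finset.sum_le_card_nsmul _ _ _ hfg
    have hB : 0 ≤ (∑ q ∈ barelyIntersectingPairs n 1, f q.1 * g q.2) /
        (barelyIntersectingPairs n 1).card :=
      div_nonneg (Finset.sum_nonneg fun q _ => mul_nonneg (hf _) (hg _)) (Nat.cast_nonneg _)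
    have hexp : 1 - ε ≤ Real.exp (-(ε ^ 2 * (1 : ℕ) / 16)) := by
      refine le_trans ?_ (Real.add_one_le_exp _)
      push_cast
      nlinarith
    calc _ ≤ (1 - ε) * M - 0 := by
          refine sub_le_sub (mul_le_mul_of_nonneg_left hA (by linarith)) hB
      _ ≤ M * ((1 : ℕ) ^ 4 * Real.exp (-(ε ^ 2 * (1 : ℕ) / 16))) := by
          rw [sub_zero, mul_comm]
          refine mul_le_mul_of_nonneg_left ?_ hM
          simpa using hexp
  · refine (average_disjointPairs_sub_le hn hf hg hM hfg hε.le).trans ?_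
    have hk2 : (2 : ℝ) ≤ k := by exact_mod_cast h2
    have h8 : (8 : ℝ) * k ≤ k ^ 4 := by
      calc (8 : ℝ) * k = 2 ^ 3 * k := by norm_num
        _ ≤ k ^ 3 * k := by gcongr
        _ = k ^ 4 := by ring
    gcongr
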